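/- Let $\Omega\subset\mathbb{R}^m$ be a bounded open set (for instance a bounded Lipschitz domain with $1\le m\le 3$), let $\alpha,\beta>0$, and let $c,d:\mathbb{R}\to\mathbb{R}$ be continuous functions such that (A1) $c\in W^{1,\infty}(\mathbb{R})$ and $0<\underline c\le c(x)\le\overline c<\infty$ for all $x\in\mathbb{R}$; (A2) $d\in W^{2,\infty}_{\mathrm{loc}}(\mathbb{R})$ with $d(x)\ge 0$ and $d(x)\ge \underline d\,|x|-d_1$ for all $x\in\mathbb{R}$, and $|d''(x)|\le\overline d$ for almost every $x\in\mathbb{R}$, with real constants $\underline c,\overline c,\underline d,d_1,\overline d$. Let $(\cdot,\cdot)$ denote the scalar product of $L^2(\Omega)$. For a finite-dimensional subspace $V_h\subset H^1(\Omega)$, $S_h^{n-1}\in V_h$ and $\tau>0$, consider the problem of finding $S_h^n\in V_h$ such that $$\Big(c(|\nabla S_h^{n-1}|)\,\tfrac{1}{\tau}\big(S_h^n-S_h^{n-1}\big),v_h\Big)+(\alpha\nabla S_h^n,\nabla v_h)+\Big(\beta\,\frac{d(S_h^n)-d(S_h^{n-1})}{S_h^n-S_h^{n-1}},v_h\Big)=0\qquad\text{for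 all } v_h\in V_h, \tag{$*$}$$ where the difference quotient is understood as $d'(S_h^n)$ wherever $S_h^n-S_h^{n-1}=0$. Then there is $\tau_0>0$, independent of $V_h$ and $S_h^{n-1}$, such that for every finite-dimensional subspace $V_h\subset H^1(\Omega)$ and every $S_h^{n-1}\in V_h$: (i) for every $\tau>0$, problem $(*)$ has at least one solution $S_h^n\in V_h$; (ii) for every $0<\tau\le\tau_0$, problem $(*)$ has exactly one solution $S_h^n\in V_h$. -/

import Mathlib

open MeasureTheory
open scoped ContDiff ENNReal

/-- `g` is the weak derivative of `f` in the direction `v` on `Ω`, tested with `C_c^∞(Ω)`. -/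
def IsWeakDeriv {E : Type*} [NormedAddCommGroup E] [NormedSpace ℝ E] [MeasureSpace E]
    (Ω : Set E) (v : E) (f g : E → ℝ) : Prop :=
  ∀ φ : E → ℝ, ContDiff ℝ ∞ φ → HasCompactSupport φ → tsupport φ ⊆ Ω →
    ∫ x in Ω, f x * fderiv ℝ φ x v = - ∫ x in Ω, g x * φ x

theorem integrable_Lp_mul_of_hasCompactSupport {E : Type*} [NormedAddCommGroup E]
    [MeasureSpace E] [BorelSpace E] [IsFiniteMeasureOnCompacts (volume : Measure E)] {Ω : Set E}
    {f ψ : E → ℝ} (hf : MemLp f 2 (volume.restrict Ω)) (hψ : Continuous ψ)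
    (hc : HasCompactSupport ψ) : Integrable (fun x => f x * ψ x) (volume.restrict Ω) :=
  hf.integrable_mul (q := 2) (hψ.memLp_of_hasCompactSupport hc)

theorem continuous_hasCompactSupport_fderiv_apply {E : Type*} [NormedAddCommGroup E]
    [NormedSpace ℝ E] {φ : E → ℝ} (h : ContDiff ℝ ∞ φ) (hc : HasCompactSupport φ) (v : E) :
    Continuous (fun x => fderiv ℝ φ x v) ∧ HasCompactSupport (fun x => fderiv ℝ φ x v) :=
  ⟨(h.continuous_fderiv (by simp)).clm_apply continuous_const,
    (hc.fderiv (𝕜 := ℝ)).comp_left (g := fun L : E →L[ℝ] ℝ => L v) (by simp)⟩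

section Sobolev

variable {m : ℕ}

/-- The Sobolev space `H¹(Ω)`, `Ω ⊆ ℝ^m`: an element is a function `u ∈ L²(Ω)` stored together
with its weak gradient in `L²(Ω; ℝ^m)`. By `H1.ext` it is determined by the function alone when
`Ω` is open. -/
noncomputable def H1 (Ω : Set (EuclideanSpace ℝ (Fin m))) :
    Submodule ℝ (Lp ℝ 2 (volume.restrict Ω) ×
      Lp (EuclideanSpace ℝ (Fin m)) 2 (volume.restrict Ω)) where
  carrier := {p | ∀ i : Fin m,
    IsWeakDeriv Ω (EuclideanSpace.single i (1 : ℝ)) (fun x => p.1 x) (fun x => p.2 x i)}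
  zero_mem' := by
    intro i φ _ _ _
    have h1 := Lp.coeFn_zero ℝ 2 (volume.restrict Ω)
    have h2 := Lp.coeFn_zero (EuclideanSpace ℝ (Fin m)) 2 (volume.restrict Ω)
    have e1 : ∫ x in Ω, (0 : Lp ℝ 2 (volume.restrict Ω)) x *
        fderiv ℝ φ x (EuclideanSpace.single i (1 : ℝ)) = 0 := by
      apply integral_eq_zero_of_ae
      filter_upwards [h1] with x hx
      rw [hx]
      simp
    have e2 : ∫ x in Ω, (0 : Lp (EuclideanSpace ℝ (Fin m)) 2 (volume.restrict Ω)) x i * φ x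
        = 0 := by
      apply integral_eq_zero_of_ae
      filter_upwards [h2] with x hx
      rw [hx]
      simp
    simp only [Prod.fst_zero, Prod.snd_zero]
    rw [e1, e2, neg_zero]
  add_mem' := by
    intro p q hp hq i φ h hc hs
    obtain ⟨k1, k2⟩ := continuous_hasCompactSupport_fderiv_apply h hc
      (EuclideanSpace.single i (1 : ℝ))
    have hp2 := (Lp.memLp p.2).eval_piLp i
    have hq2 := (Lp.memLp q.2).eval_piLp i
    have e1 : ∫ x in Ω, (p + q).1 x * fderiv ℝ φ x (EuclideanSpace.single i (1 : ℝ))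
        = (∫ x in Ω, p.1 x * fderiv ℝ φ x (EuclideanSpace.single i (1 : ℝ))) +
          ∫ x in Ω, q.1 x * fderiv ℝ φ x (EuclideanSpace.single i (1 : ℝ)) := by
      rw [← integral_add (integrable_Lp_mul_of_hasCompactSupport (Lp.memLp p.1) k1 k2)
        (integrable_Lp_mul_of_hasCompactSupport (Lp.memLp q.1) k1 k2)]
      apply integral_congr_ae
      filter_upwards [Lp.coeFn_add p.1 q.1] with x hx
      simp only [Prod.fst_add, Prod.snd_add, hx, Pi.add_apply, PiLp.add_apply, add_mul]
    have e2 : ∫ x in Ω, (p + q).2 x i * φ x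
        = (∫ x in Ω, p.2 x i * φ x) + ∫ x in Ω, q.2 x i * φ x := by
      rw [← integral_add (integrable_Lp_mul_of_hasCompactSupport hp2 h.continuous hc)
        (integrable_Lp_mul_of_hasCompactSupport hq2 h.continuous hc)]
      apply integral_congr_ae
      filter_upwards [Lp.coeFn_add p.2 q.2] with x hx
      simp only [Prod.fst_add, Prod.snd_add, hx, Pi.add_apply, PiLp.add_apply, add_mul]
    rw [e1, e2, hp i φ h hc hs, hq i φ h hc hs]
    ring
  smul_mem' := by
    intro a p hp i φ h hc hs
    have e1 : ∫ x in Ω, (a • p).1 x * fderiv ℝ φ x (EuclideanSpace.single i (1 : ℝ))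
        = a * ∫ x in Ω, p.1 x * fderiv ℝ φ x (EuclideanSpace.single i (1 : ℝ)) := by
      rw [← integral_const_mul]
      apply integral_congr_ae
      filter_upwards [Lp.coeFn_smul a p.1] with x hx
      simp only [Prod.smul_fst, Prod.smul_snd, hx, Pi.smul_apply, PiLp.smul_apply, smul_eq_mul,
        mul_assoc]
    have e2 : ∫ x in Ω, (a • p).2 x i * φ x = a * ∫ x in Ω, p.2 x i * φ x := by
      rw [← integral_const_mul]
      apply integral_congr_ae
      filter_upwards [Lp.coeFn_smul a p.2] with x hx
      simp only [Prod.smul_fst, Prod.smul_snd, hx, Pi.smul_apply, PiLp.smul_apply, smul_eq_mul,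
        mul_assoc]
    rw [e1, e2, hp i φ h hc hs, mul_neg]

namespace H1

variable {Ω : Set (EuclideanSpace ℝ (Fin m))}

/-- The underlying `L²` function of an element of `H¹(Ω)`. -/
noncomputable def fn (u : H1 Ω) : EuclideanSpace ℝ (Fin m) → ℝ := u.1.1

/-- The weak gradient of an element of `H¹(Ω)`. -/
noncomputable def grad (u : H1 Ω) : EuclideanSpace ℝ (Fin m) → EuclideanSpace ℝ (Fin m) := u.1.2

/-- On an open set, an element of `H¹(Ω)` is determined by its `L²` function. -/
theorem ext (hΩ : IsOpen Ω) {u w : H1 Ω} (h : u.1.1 = w.1.1) : u = w := by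
  refine Subtype.ext (Prod.ext h ?_)
  have key : ∀ i : Fin m, ∀ᵐ x ∂(volume.restrict Ω), u.1.2 x i = w.1.2 x i := by
    intro i
    have hu2 := (Lp.memLp u.1.2).eval_piLp i
    have hw2 := (Lp.memLp w.1.2).eval_piLp i
    have hl : LocallyIntegrableOn (fun x => u.1.2 x i - w.1.2 x i) Ω volume := by
      refine locallyIntegrableOn_of_locallyIntegrable_restrict ?_
      exact (hu2.sub hw2).locallyIntegrable (by norm_num)
    have := hΩ.ae_eq_zero_of_integral_contDiff_smul_eq_zero (μ := volume) hl ?_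
    · rw [ae_restrict_iff' hΩ.measurableSet]
      filter_upwards [this] with x hx hxΩ
      exact sub_eq_zero.mp (hx hxΩ)
    · intro φ hφ hc hs
      have a1 := u.2 i φ hφ hc hs
      have a2 := w.2 i φ hφ hc hs
      simp only [h] at a1
      have a3 : ∫ x in Ω, u.1.2 x i * φ x = ∫ x in Ω, w.1.2 x i * φ x := by linarith
      rw [← setIntegral_eq_integral_of_forall_compl_eq_zero (s := Ω)]
      · have e : ∀ x, φ x • (u.1.2 x i - w.1.2 x i) = u.1.2 x i * φ x - w.1.2 x i * φ x := by
          intro x; simp only [smul_eq_mul]; ring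
        simp only [e]
        rw [integral_sub (integrable_Lp_mul_of_hasCompactSupport hu2 hφ.continuous hc)
          (integrable_Lp_mul_of_hasCompactSupport hw2 hφ.continuous hc), a3, sub_self]
      · intro x hx
        have : φ x = 0 := image_eq_zero_of_notMem_tsupport (fun hx' => hx (hs hx'))
        simp [this]
  apply Lp.ext
  filter_upwards [ae_all_iff.mpr key] with x hx
  ext i
  exact hx i

end H1

end Sobolev

/-- `f ∈ W^{1,∞}(ℝ)`, `f` being the continuous representative. -/
def MemW1Inf (f : ℝ → ℝ) : Prop :=
  Continuous f ∧ MemLp f ∞ volume ∧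
    ∃ f₁ : ℝ → ℝ, MemLp f₁ ∞ volume ∧ IsWeakDeriv Set.univ 1 f f₁

/-- `f ∈ L^∞_loc(ℝ)`. -/
def MemLinfLoc (f : ℝ → ℝ) : Prop :=
  ∀ K : Set ℝ, IsCompact K → MemLp f ∞ (volume.restrict K)

/-- `f ∈ W^{2,∞}_loc(ℝ)`, `f` being the continuous representative, with `|f''| ≤ M` almost
everywhere. -/
def MemW2InfLocWithBound (f : ℝ → ℝ) (M : ℝ) : Prop :=
  Continuous f ∧ ∃ f₁ f₂ : ℝ → ℝ, MemLinfLoc f₁ ∧ MemLinfLoc f₂ ∧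
    IsWeakDeriv Set.univ 1 f f₁ ∧ IsWeakDeriv Set.univ 1 f₁ f₂ ∧ ∀ᵐ x, |f₂ x| ≤ M

/-- Assumption on the mobility coefficient `c`. -/
structure AssumptionA1 (c : ℝ → ℝ) (cLow cUp : ℝ) : Prop where
  sobolev : MemW1Inf c
  pos : 0 < cLow
  lower : ∀ x, cLow ≤ c x
  upper : ∀ x, c x ≤ cUp

/-- Assumption on the potential `d`. -/
structure AssumptionA2 (d : ℝ → ℝ) (dLow d₁ dUp : ℝ) : Prop where
  sobolev : MemW2InfLocWithBound d dUp
  nonneg : ∀ x, 0 ≤ d x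
  growth : ∀ x, dLow * |x| - d₁ ≤ d x

/-- The difference quotient `(d(s) - d(r)) / (s - r)`, set to `d'(s)` where `s = r`. -/
noncomputable def diffQuot (d : ℝ → ℝ) (s r : ℝ) : ℝ :=
  if s - r = 0 then deriv d s else (d s - d r) / (s - r)

/-- `S ∈ V_h` solves one step, of size `τ`, of the fully discrete scheme starting from
`S₀ ∈ V_h`. -/
def IsStepSolution {m : ℕ} {Ω : Set (EuclideanSpace ℝ (Fin m))} (α β : ℝ) (c d : ℝ → ℝ)
    (Vh : Submodule ℝ (H1 Ω)) (τ : ℝ) (S₀ S : Vh) : Prop :=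
  ∀ v : Vh,
    (∫ x in Ω, c ‖H1.grad S₀.1 x‖ * ((1 / τ) * (H1.fn S.1 x - H1.fn S₀.1 x)) * H1.fn v.1 x)
      + (∫ x in Ω, inner ℝ (α • H1.grad S.1 x) (H1.grad v.1 x))
      + (∫ x in Ω, β * diffQuot d (H1.fn S.1 x) (H1.fn S₀.1 x) * H1.fn v.1 x) = 0

/-! The scheme is variational. For fixed `S₀` the difference quotient has a primitive in its first
argument, so the left side of the equation is the derivative of an energy on the finite-dimensional
space `Vh`, and solutions are its critical points.

Existence for every step size: tested with the increment `S - S₀`, the quotient term becomes `d(S) -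
d(S₀)`, which is at least `-d(S₀)` because `d ≥ 0`. The mobility and diffusion terms control the
squared H¹ norm of the increment up to constants. Hence the derivative of the energy points outwards
on a large sphere around `S₀`, and a minimiser over the ball is an interior critical point
(`reaction_coercive`, `exists_forall_eq_zero_of_expansion`).

Uniqueness for small steps: the bound on `d''` makes `d'` Lipschitz, hence the quotient Lipschitz in
`S`, with constant `dUp`. Once `cLow / τ` exceeds `β * dUp`, the zeroth-order operator is strongly
monotone in L² (`reaction_strongly_monotone`), so the L² parts of two solutions agree, and then
their weak gradients do too. This threshold involves neither `Vh` nor `S₀`. -/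

/-! ### Weak derivatives on the line and C^{1,1} regularity of the potential. -/

theorem HasCompactSupport.exists_eq_zero_of_notMem_Ioo {φ : ℝ → ℝ} (hc : HasCompactSupport φ) :
    ∃ R > 0, ∀ x, x ∉ Set.Ioo (-R) R → φ x = 0 := by
  obtain ⟨R, hR, hsub⟩ := hc.isCompact.isBounded.subset_ball_lt 0 0
  refine ⟨R, hR, fun x hx => image_eq_zero_of_notMem_tsupport fun h => hx ?_⟩
  have := hsub h
  rwa [Real.ball_eq_Ioo, zero_sub, zero_add] at this

theorem integral_eq_intervalIntegral_of_eq_zero {f : ℝ → ℝ} {a b : ℝ} (hab : a ≤ b)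
    (h : ∀ x, x ∉ Set.Ioo a b → f x = 0) : ∫ x, f x = ∫ x in a..b, f x := by
  rw [intervalIntegral.integral_of_le hab,
    setIntegral_eq_integral_of_forall_compl_eq_zero fun x hx => h x fun hx' =>
      hx (Set.Ioo_subset_Ioc_self hx')]

/-- The primitive started to the left of the support vanishes there, and it vanishes to the right
because the mean is zero. -/
theorem exists_hasCompactSupport_deriv_eq {η : ℝ → ℝ} (h : ContDiff ℝ ∞ η)
    (hc : HasCompactSupport η) (h0 : ∫ x, η x = 0) :
    ∃ Φ : ℝ → ℝ, ContDiff ℝ ∞ Φ ∧ HasCompactSupport Φ ∧ deriv Φ = η := by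
  obtain ⟨R, hR, hz⟩ := hc.exists_eq_zero_of_notMem_Ioo
  have hd : ∀ x, HasDerivAt (fun x => ∫ t in (-R)..x, η t) (η x) x := fun x =>
    h.continuous.integral_hasStrictDerivAt (-R) x |>.hasDerivAt
  have hd' : deriv (fun x => ∫ t in (-R)..x, η t) = η := funext fun x => (hd x).deriv
  refine ⟨fun x => ∫ t in (-R)..x, η t, ?_, ?_, hd'⟩
  · rw [contDiff_infty_iff_deriv, hd']
    exact ⟨fun x => (hd x).differentiableAt, h⟩
  · refine HasCompactSupport.intro (isCompact_Icc (a := -R) (b := R)) fun x hx => ?_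
    rcases lt_or_ge x (-R) with hlt | hge
    · show ∫ t in (-R)..x, η t = 0
      rw [intervalIntegral.integral_congr (g := fun _ => (0 : ℝ))]
      · simp
      · intro t ht
        rw [Set.uIcc_of_ge hlt.le] at ht
        exact hz t fun h' => absurd h'.1 (not_lt.mpr ht.2)
    · have hgt : R < x := by
        by_contra hle
        exact hx ⟨hge, not_lt.mp hle⟩
      show ∫ t in (-R)..x, η t = 0
      rw [← integral_eq_intervalIntegral_of_eq_zero (by linarith), h0]
      intro t ht
      refine hz t fun h' => ht ⟨h'.1, h'.2.trans hgt⟩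

theorem MeasureTheory.LocallyIntegrable.mul_continuous_hasCompactSupport {f ψ : ℝ → ℝ}
    (hf : LocallyIntegrable f) (hψ : Continuous ψ) (hc : HasCompactSupport ψ) :
    Integrable (fun x => f x * ψ x) := by
  simpa [mul_comm] using hf.integrable_smul_left_of_hasCompactSupport hψ hc

theorem MeasureTheory.LocallyIntegrable.intervalIntegrable {f : ℝ → ℝ} (hf : LocallyIntegrable f)
    (a b : ℝ) : IntervalIntegrable f volume a b :=
  (hf.integrableOn_isCompact isCompact_uIcc).intervalIntegrable

/-- The du Bois-Reymond lemma: a function with zero weak derivative is constant. -/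
theorem ae_eq_const_of_isWeakDeriv_zero {f : ℝ → ℝ} (hf : LocallyIntegrable f)
    (h : IsWeakDeriv Set.univ 1 f fun _ => 0) : ∃ C, ∀ᵐ x, f x = C := by
  let ρ : ContDiffBump (0 : ℝ) := ⟨1, 2, by norm_num, by norm_num⟩
  let ψ : ℝ → ℝ := ρ.normed volume
  have hψ : ContDiff ℝ ∞ ψ := ρ.contDiff_normed
  have hψc : HasCompactSupport ψ := ρ.hasCompactSupport_normed
  have hψi : ∫ x, ψ x = 1 := ρ.integral_normed
  refine ⟨∫ x, f x * ψ x, ?_⟩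
  refine ae_eq_of_integral_contDiff_smul_eq hf (locallyIntegrable_const _) fun φ hφ hφc => ?_
  have i1 := hφ.continuous.integrable_of_hasCompactSupport (μ := volume) hφc
  have i2 := (hψ.continuous.integrable_of_hasCompactSupport (μ := volume) hψc).const_mul (∫ x, φ x)
  -- Subtracting a multiple of a fixed bump of unit mass makes any test function mean-free, hence
  -- the derivative of a test function; this forces the constant to be `∫ f ψ`.
  obtain ⟨Φ, hΦ, hΦc, hΦd⟩ := exists_hasCompactSupport_deriv_eq
    (η := fun x => φ x - (∫ x, φ x) * ψ x) (hφ.sub (contDiff_const.mul hψ))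
    (hφc.sub hψc.mul_left) (by
      rw [integral_sub i1 i2, integral_const_mul, hψi, mul_one, sub_self])
  have key := h Φ hΦ hΦc (Set.subset_univ _)
  simp only [Measure.restrict_univ, fderiv_apply_one_eq_deriv, hΦd, zero_mul, integral_zero,
    neg_zero] at key
  have j1 := hf.mul_continuous_hasCompactSupport hφ.continuous hφc
  have j2 := (hf.mul_continuous_hasCompactSupport hψ.continuous hψc).const_mul
    (∫ x, φ x)
  have e : ∀ x, f x * (φ x - (∫ x, φ x) * ψ x) = f x * φ x - (∫ x, φ x) * (f x * ψ x) :=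
    fun x => by ring
  simp only [e] at key
  rw [integral_sub j1 j2, integral_const_mul] at key
  simp only [smul_eq_mul, integral_mul_const]
  simp only [mul_comm (φ _)]
  linarith

/-- Integration by parts for absolutely continuous functions; Lebesgue differentiation identifies
the derivative of the primitive almost everywhere. -/
theorem isWeakDeriv_intervalIntegral {g : ℝ → ℝ} (hg : LocallyIntegrable g) :
    IsWeakDeriv Set.univ 1 (fun x => ∫ t in (0 : ℝ)..x, g t) g := by
  intro φ hφ hc _
  simp only [Measure.restrict_univ, fderiv_apply_one_eq_deriv]
  obtain ⟨R, hR, hz⟩ := hc.exists_eq_zero_of_notMem_Ioo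
  obtain ⟨R', hR', hz'⟩ := hc.deriv.exists_eq_zero_of_notMem_Ioo
  set S := max R R'
  have hSR : R ≤ S := le_max_left _ _
  have hSR' : R' ≤ S := le_max_right _ _
  have hS : -S ≤ S := by linarith
  have zz : ∀ x, x ∉ Set.Ioo (-S) S → φ x = 0 := fun x hx => hz x fun h =>
    hx ⟨by linarith [h.1], by linarith [h.2]⟩
  have zz' : ∀ x, x ∉ Set.Ioo (-S) S → deriv φ x = 0 := fun x hx => hz' x fun h =>
    hx ⟨by linarith [h.1], by linarith [h.2]⟩
  rw [integral_eq_intervalIntegral_of_eq_zero hS fun x hx => by rw [zz' x hx, mul_zero],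
    integral_eq_intervalIntegral_of_eq_zero hS fun x hx => by rw [zz x hx, mul_zero]]
  have hii : IntervalIntegrable g volume (-S) S := hg.intervalIntegrable _ _
  have ac1 := hii.absolutelyContinuousOnInterval_intervalIntegral (c := 0)
    (by rw [Set.uIcc_of_le hS]; constructor <;> linarith)
  have ac2 : AbsolutelyContinuousOnInterval φ (-S) S :=
    ContDiffOn.absolutelyContinuousOnInterval (hφ.of_le (by simp)).contDiffOn
  rw [ac1.integral_mul_deriv_eq_deriv_mul ac2, zz S (by simp), zz (-S) (by simp)]
  simp only [mul_zero, sub_zero, zero_sub, neg_inj]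
  apply intervalIntegral.integral_congr_ae
  filter_upwards [_root_.LocallyIntegrable.ae_hasDerivAt_integral hg] with x hx _
  rw [(hx 0).deriv]

theorem ae_eq_const_add_intervalIntegral_of_isWeakDeriv {f g : ℝ → ℝ} (hf : LocallyIntegrable f)
    (hg : LocallyIntegrable g) (h : IsWeakDeriv Set.univ 1 f g) :
    ∃ C, ∀ᵐ x, f x = C + ∫ t in (0 : ℝ)..x, g t := by
  have hcont : Continuous fun x => ∫ t in (0 : ℝ)..x, g t :=
    intervalIntegral.continuous_primitive hg.intervalIntegrable 0
  obtain ⟨C, hC⟩ := ae_eq_const_of_isWeakDeriv_zero (hf.sub hcont.locallyIntegrable) (by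
    intro φ hφ hc hs
    have h1 := h φ hφ hc hs
    have h2 := isWeakDeriv_intervalIntegral hg φ hφ hc hs
    simp only [Measure.restrict_univ, Pi.sub_apply, sub_mul, zero_mul, integral_zero,
      neg_zero] at h1 h2 ⊢
    obtain ⟨k1, k2⟩ := continuous_hasCompactSupport_fderiv_apply hφ hc 1
    rw [integral_sub (hf.mul_continuous_hasCompactSupport k1 k2)
      (hcont.locallyIntegrable.mul_continuous_hasCompactSupport k1 k2), h1, h2,
      sub_self])
  refine ⟨C, ?_⟩
  filter_upwards [hC] with x hx
  simp only [Pi.sub_apply] at hx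
  linarith

theorem MemLinfLoc.locallyIntegrable {f : ℝ → ℝ} (hf : MemLinfLoc f) : LocallyIntegrable f := by
  rw [locallyIntegrable_iff]
  intro K hK
  have : IsFiniteMeasure (volume.restrict K) := ⟨by simpa using hK.measure_lt_top⟩
  exact (hf K hK).integrable le_top

/-- A function in `W^{2,∞}_loc` with bounded second derivative is `C^{1,1}`. -/
theorem MemW2InfLocWithBound.exists_hasDerivAt {d : ℝ → ℝ} {M : ℝ}
    (h : MemW2InfLocWithBound d M) :
    ∃ k : ℝ → ℝ, (∀ x, HasDerivAt d (k x) x) ∧ ∀ x y, |k x - k y| ≤ M * |x - y| := by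
  obtain ⟨hd, f₁, f₂, h1, h2, w1, w2, hb⟩ := h
  have l1 := h1.locallyIntegrable
  have l2 := h2.locallyIntegrable
  obtain ⟨C₁, e1⟩ := ae_eq_const_add_intervalIntegral_of_isWeakDeriv l1 l2 w2
  obtain ⟨C₀, e0⟩ := ae_eq_const_add_intervalIntegral_of_isWeakDeriv hd.locallyIntegrable l1 w1
  set k : ℝ → ℝ := fun x => C₁ + ∫ t in (0 : ℝ)..x, f₂ t
  have hk : Continuous k := continuous_const.add
    (intervalIntegral.continuous_primitive l2.intervalIntegrable 0)
  -- Both sides are continuous, so the almost-everywhere identity holds everywhere.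
  have e0' : d = fun x => C₀ + ∫ t in (0 : ℝ)..x, k t := by
    refine (hd.ae_eq_iff_eq volume (continuous_const.add
      (intervalIntegral.continuous_primitive (fun a b => hk.intervalIntegrable _ _) 0))).1 ?_
    filter_upwards [e0] with x hx
    rw [hx]
    refine congrArg (C₀ + ·) (intervalIntegral.integral_congr_ae ?_)
    filter_upwards [e1] with t ht _ using ht
  refine ⟨k, fun x => ?_, fun x y => ?_⟩
  · rw [e0']
    exact (hk.integral_hasStrictDerivAt 0 x).hasDerivAt.const_add C₀
  · have : k x - k y = ∫ t in y..x, f₂ t := by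
      simp only [k, add_sub_add_left_eq_sub]
      exact intervalIntegral.integral_interval_sub_left (l2.intervalIntegrable _ _)
        (l2.intervalIntegrable _ _)
    rw [this, ← Real.norm_eq_abs]
    exact intervalIntegral.norm_integral_le_of_norm_le_const_ae
      (by filter_upwards [hb] with t ht _ using ht)

/-! ### The difference quotient and its primitive. -/

section DiffQuot

variable {d k : ℝ → ℝ} {M : ℝ}

theorem continuous_of_abs_sub_le (hL : ∀ x y, |k x - k y| ≤ M * |x - y|) : Continuous k := by
  refine (LipschitzWith.of_dist_le' (K := M) fun x y => ?_).continuous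
  simpa [Real.dist_eq] using hL x y

theorem diffQuot_mul_sub (d : ℝ → ℝ) (s r : ℝ) : diffQuot d s r * (s - r) = d s - d r := by
  unfold diffQuot
  split_ifs with h
  · rw [h, mul_zero, sub_eq_zero.mp h, sub_self]
  · exact div_mul_cancel₀ _ h

/-- The averaged form of the quotient includes the diagonal `s = r`, so continuity and Lipschitz
bounds follow without case distinctions. -/
theorem diffQuot_eq_integral (hd : ∀ x, HasDerivAt d (k x) x) (hk : Continuous k) (s r : ℝ) :
    diffQuot d s r = ∫ t in (0 : ℝ)..1, k (r + t * (s - r)) := by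
  unfold diffQuot
  split_ifs with h
  · simp [(hd r).deriv, sub_eq_zero.mp h]
  · rw [div_eq_iff h, mul_comm, ← smul_eq_mul (s - r)]
    have := intervalIntegral.smul_integral_comp_add_mul (f := k) (a := 0) (b := 1) (s - r) r
    simp only [mul_comm _ (s - r)]
    rw [this, intervalIntegral.integral_eq_sub_of_hasDerivAt (fun x _ => hd x)
      (hk.intervalIntegrable _ _)]
    ring_nf

theorem continuous_diffQuot (hd : ∀ x, HasDerivAt d (k x) x) (hk : Continuous k) :
    Continuous fun p : ℝ × ℝ => diffQuot d p.1 p.2 := by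
  simp only [diffQuot_eq_integral hd hk]
  apply intervalIntegral.continuous_parametric_intervalIntegral_of_continuous'
  unfold Function.uncurry
  fun_prop

theorem abs_diffQuot_sub_le (hd : ∀ x, HasDerivAt d (k x) x)
    (hL : ∀ x y, |k x - k y| ≤ M * |x - y|) (s s' r r' : ℝ) :
    |diffQuot d s r - diffQuot d s' r'| ≤ M * (|s - s'| + |r - r'|) := by
  have hk := continuous_of_abs_sub_le hL
  have hM : 0 ≤ M := by simpa using (abs_nonneg _).trans (hL 1 0)
  rw [diffQuot_eq_integral hd hk, diffQuot_eq_integral hd hk, ← intervalIntegral.integral_sub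
    (Continuous.intervalIntegrable (by fun_prop) _ _)
    (Continuous.intervalIntegrable (by fun_prop) _ _)]
  have := intervalIntegral.norm_integral_le_of_norm_le_const (a := 0) (b := 1)
    (f := fun t => k (r + t * (s - r)) - k (r' + t * (s' - r')))
    (C := M * (|s - s'| + |r - r'|)) fun t ht => by
      rw [Set.uIoc_of_le zero_le_one] at ht
      refine (hL _ _).trans (mul_le_mul_of_nonneg_left ?_ hM)
      have e : r + t * (s - r) - (r' + t * (s' - r')) = t * (s - s') + (1 - t) * (r - r') := by
        ring
      rw [e]
      refine (abs_add_le _ _).trans ?_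
      rw [abs_mul, abs_mul, abs_of_pos ht.1, abs_of_nonneg (sub_nonneg.mpr ht.2)]
      have := ht.1
      have := ht.2
      gcongr
      · exact mul_le_of_le_one_left (abs_nonneg _) ht.2
      · exact mul_le_of_le_one_left (abs_nonneg _) (by linarith)
  simpa using this

theorem abs_diffQuot_le (hd : ∀ x, HasDerivAt d (k x) x)
    (hL : ∀ x y, |k x - k y| ≤ M * |x - y|) (s r : ℝ) :
    |diffQuot d s r| ≤ |k 0| + M * (|s| + |r|) := by
  have h := abs_diffQuot_sub_le hd hL s 0 r 0
  have h0 : diffQuot d 0 0 = k 0 := by simp [diffQuot, (hd 0).deriv]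
  rw [h0, sub_zero, sub_zero] at h
  have := abs_sub_abs_le_abs_sub (diffQuot d s r) (k 0)
  linarith

theorem abs_le_of_hasDerivAt_lipschitz (hd : ∀ x, HasDerivAt d (k x) x)
    (hL : ∀ x y, |k x - k y| ≤ M * |x - y|) (s : ℝ) :
    |d s| ≤ |d 0| + (|k 0| + M * |s|) * |s| := by
  have h := diffQuot_mul_sub d s 0
  have h1 := abs_diffQuot_le hd hL s 0
  have e : d s = d 0 + diffQuot d s 0 * s := by rw [sub_zero] at h; linarith
  rw [e]
  refine (abs_add_le _ _).trans ?_
  rw [abs_mul]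
  simp only [abs_zero, add_zero] at h1
  gcongr

/-- A primitive of the difference quotient in its first argument. -/
noncomputable def diffQuotPrimitive (d : ℝ → ℝ) (s r : ℝ) : ℝ :=
  ∫ t in (0 : ℝ)..s, diffQuot d t r

theorem continuous_diffQuotPrimitive (hd : ∀ x, HasDerivAt d (k x) x) (hk : Continuous k) :
    Continuous fun p : ℝ × ℝ => diffQuotPrimitive d p.1 p.2 := by
  have h := continuous_diffQuot hd hk
  refine intervalIntegral.continuous_parametric_intervalIntegral_of_continuous
    (f := fun (p : ℝ × ℝ) t => diffQuot d t p.2) ?_ continuous_fst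
  exact h.comp (g := fun p : ℝ × ℝ => diffQuot d p.1 p.2)
    (f := fun q : (ℝ × ℝ) × ℝ => (q.2, q.1.2)) (by fun_prop)

/-- The remainder is the integral over an interval of length `|h|` of an increment that the
Lipschitz bound keeps below `M * |h|`. -/
theorem abs_diffQuotPrimitive_sub_le (hd : ∀ x, HasDerivAt d (k x) x)
    (hL : ∀ x y, |k x - k y| ≤ M * |x - y|) (s h r : ℝ) :
    |diffQuotPrimitive d (s + h) r - diffQuotPrimitive d s r - diffQuot d s r * h|
      ≤ M * h ^ 2 := by
  have hk := continuous_of_abs_sub_le hL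
  have hM : 0 ≤ M := by simpa using (abs_nonneg _).trans (hL 1 0)
  have hc : Continuous fun t => diffQuot d t r :=
    (continuous_diffQuot hd hk).comp (f := fun t : ℝ => (t, r)) (by fun_prop)
  have e : diffQuotPrimitive d (s + h) r - diffQuotPrimitive d s r - diffQuot d s r * h
      = ∫ t in s..(s + h), (diffQuot d t r - diffQuot d s r) := by
    rw [intervalIntegral.integral_sub (hc.intervalIntegrable _ _) intervalIntegrable_const]
    unfold diffQuotPrimitive
    rw [intervalIntegral.integral_interval_sub_left (hc.intervalIntegrable _ _)
      (hc.intervalIntegrable _ _), intervalIntegral.integral_const, smul_eq_mul]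
    ring
  rw [e]
  have := intervalIntegral.norm_integral_le_of_norm_le_const (a := s) (b := s + h)
    (f := fun t => diffQuot d t r - diffQuot d s r) (C := M * |h|) fun t ht => by
      refine (abs_diffQuot_sub_le hd hL t s r r).trans (mul_le_mul_of_nonneg_left ?_ hM)
      rw [sub_self, abs_zero, add_zero]
      simpa using Set.abs_sub_left_of_mem_uIcc (Set.uIoc_subset_uIcc ht)
  rw [add_sub_cancel_left, mul_assoc, ← abs_mul, ← sq, abs_sq] at this
  exact this

end DiffQuot

/-! ### Critical points in finite dimension. -/

/-- A quadratic first-order expansion with derivative pointing outwards on a sphere yields a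
critical point. -/
theorem exists_forall_eq_zero_of_expansion {E : Type*} [NormedAddCommGroup E] [NormedSpace ℝ E]
    [FiniteDimensional ℝ E] {J : E → ℝ} {F : E → E →ₗ[ℝ] ℝ} {C R : ℝ} (hR : 0 < R)
    (hJ : ∀ w v, |J (w + v) - J w - F w v| ≤ C * ‖v‖ ^ 2)
    (hpos : ∀ w, ‖w‖ = R → 0 < F w w) : ∃ w, ∀ v, F w v = 0 := by
  have hder : ∀ w, HasFDerivAt J (LinearMap.toContinuousLinearMap (F w)) w := by
    intro w
    rw [hasFDerivAt_iff_isLittleO_nhds_zero]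
    refine Asymptotics.IsBigO.trans_isLittleO (g := fun v : E => ‖v‖ ^ 2) ?_ ?_
    · refine Asymptotics.IsBigO.of_bound C (Filter.Eventually.of_forall fun v => ?_)
      simpa using hJ w v
    · exact (Asymptotics.isLittleO_norm_pow_id one_lt_two)
  have hcont : Continuous J := continuous_iff_continuousAt.mpr fun w => (hder w).continuousAt
  have : ProperSpace E := FiniteDimensional.proper ℝ E
  obtain ⟨w, hw, hmin⟩ := (isCompact_closedBall (0 : E) R).exists_isMinOn
    ⟨0, by simp [hR.le]⟩ hcont.continuousOn
  rw [mem_closedBall_zero_iff] at hw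
  rcases hw.lt_or_eq with hlt | heq
  · have hloc : IsLocalMin J w :=
      hmin.isLocalMin (Metric.closedBall_mem_nhds_of_mem (by simpa using hlt))
    have := hloc.hasFDerivAt_eq_zero (hder w)
    refine ⟨w, fun v => ?_⟩
    simpa using DFunLike.congr_fun this v
  · exfalso
    have hp := hpos w heq
    -- Moving inwards from `w` to `(1 - t) • w` changes `J` by at most `-t * F w w + C * R ^ 2 * t ^
    -- 2`; this `t` makes it negative, against minimality.
    obtain ⟨t, ht0, ht1, ht⟩ : ∃ t : ℝ, 0 < t ∧ t ≤ 1 ∧ C * R ^ 2 * t < F w w := by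
      refine ⟨min 1 (F w w / (2 * (|C| * R ^ 2 + 1))), by positivity, min_le_left _ _, ?_⟩
      set A := |C| * R ^ 2 + 1
      have hA : 0 < A := by positivity
      have h1 : C * R ^ 2 ≤ A := by
        have := mul_le_mul_of_nonneg_right (le_abs_self C) (sq_nonneg R)
        simp only [A]; linarith
      calc C * R ^ 2 * min 1 (F w w / (2 * A)) ≤ A * (F w w / (2 * A)) :=
            mul_le_mul h1 (min_le_right _ _) (by positivity) hA.le
        _ = F w w / 2 := by field_simp
        _ < F w w := by linarith
    have h1 : J w ≤ J (w + (-t) • w) := by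
      refine hmin ?_
      rw [mem_closedBall_zero_iff, show w + (-t) • w = (1 - t) • w by module, norm_smul, heq,
        Real.norm_of_nonneg (by linarith)]
      exact mul_le_of_le_one_left hR.le (by linarith)
    have h2 := (le_abs_self _).trans (hJ w ((-t) • w))
    rw [map_smul, norm_smul, heq, smul_eq_mul, norm_neg, Real.norm_of_nonneg ht0.le] at h2
    nlinarith

/-! ### The zeroth-order operator on L²: energy, coercivity, monotonicity. -/

section Reaction

variable {X : Type*} [MeasurableSpace X] {μ : Measure X}

theorem L2_inner_eq_integral_mul (f g : Lp ℝ 2 μ) : inner ℝ f g = ∫ x, f x * g x ∂μ := by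
  rw [L2.inner_def]
  simp [mul_comm]

theorem L2_inner_toLp {f : X → ℝ} (hf : MemLp f 2 μ) (g : Lp ℝ 2 μ) :
    inner ℝ (hf.toLp f) g = ∫ x, f x * g x ∂μ := by
  rw [L2_inner_eq_integral_mul]
  refine integral_congr_ae ?_
  filter_upwards [hf.coeFn_toLp] with x hx
  rw [hx]

theorem L2_norm_sq_eq_integral (f : Lp ℝ 2 μ) : ‖f‖ ^ 2 = ∫ x, f x ^ 2 ∂μ := by
  rw [← real_inner_self_eq_norm_sq, L2_inner_eq_integral_mul]
  simp [sq]

theorem L2_integrable_mul {f g : X → ℝ} (hf : MemLp f 2 μ) (hg : MemLp g 2 μ) :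
    Integrable (fun x => f x * g x) μ :=
  hf.integrable_mul hg

/-- The zeroth-order terms of the scheme with weight `w`. -/
noncomputable def reaction (w : X → ℝ) (β : ℝ) (d : ℝ → ℝ) (s₀ s : X → ℝ) (x : X) : ℝ :=
  w x * (s x - s₀ x) + β * diffQuot d (s x) (s₀ x)

/-- The energy density whose derivative is `reaction`. -/
noncomputable def reactionEnergy (w : X → ℝ) (β : ℝ) (d : ℝ → ℝ) (s₀ s : X → ℝ) (x : X) : ℝ :=
  w x / 2 * (s x - s₀ x) ^ 2 + β * diffQuotPrimitive d (s x) (s₀ x)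

variable {w : X → ℝ} {M β wLow wUp : ℝ} {d k : ℝ → ℝ} {s₀ s : X → ℝ}

theorem memLp_weight_mul (hw : AEStronglyMeasurable w μ) (hwUp : ∀ x, |w x| ≤ wUp) {f : X → ℝ}
    (hf : MemLp f 2 μ) : MemLp (fun x => w x * f x) 2 μ := by
  refine hf.of_le_mul (c := wUp) (hw.mul hf.1) (Filter.Eventually.of_forall fun x => ?_)
  rw [norm_mul]
  exact mul_le_mul_of_nonneg_right (hwUp x) (norm_nonneg _)

variable [IsFiniteMeasure μ]

theorem memLp_diffQuot (hd : ∀ x, HasDerivAt d (k x) x)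
    (hL : ∀ x y, |k x - k y| ≤ M * |x - y|) (hs₀ : MemLp s₀ 2 μ) (hs : MemLp s 2 μ) :
    MemLp (fun x => diffQuot d (s x) (s₀ x)) 2 μ := by
  have hb : MemLp (fun x => |k 0| + M * (|s x| + |s₀ x|)) 2 μ :=
    MemLp.add (f := fun _ => |k 0|) (g := fun x => M * (|s x| + |s₀ x|)) (memLp_const _)
      (MemLp.const_mul (f := fun x => |s x| + |s₀ x|) (hs.norm.add hs₀.norm) M)
  refine hb.of_le ?_ (Filter.Eventually.of_forall fun x => ?_)
  · exact (continuous_diffQuot hd (continuous_of_abs_sub_le hL)).comp_aestronglyMeasurable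
      (hs.1.prodMk hs₀.1)
  · exact (abs_diffQuot_le hd hL _ _).trans (le_abs_self _)

theorem memLp_reaction (hw : AEStronglyMeasurable w μ) (hwUp : ∀ x, |w x| ≤ wUp)
    (hd : ∀ x, HasDerivAt d (k x) x)
    (hL : ∀ x y, |k x - k y| ≤ M * |x - y|) (hs₀ : MemLp s₀ 2 μ) (hs : MemLp s 2 μ) :
    MemLp (reaction w β d s₀ s) 2 μ :=
  (memLp_weight_mul hw hwUp (hs.sub hs₀)).add ((memLp_diffQuot hd hL hs₀ hs).const_mul β)

theorem integrable_comp_of_hasDerivAt_lipschitz (hd : ∀ x, HasDerivAt d (k x) x)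
    (hL : ∀ x y, |k x - k y| ≤ M * |x - y|) (hs : MemLp s 2 μ) :
    Integrable (fun x => d (s x)) μ := by
  have hb : Integrable (fun x => |d 0| + (|k 0| + M * |s x|) * |s x|) μ :=
    Integrable.add (f := fun _ => |d 0|) (g := fun x => (|k 0| + M * |s x|) * |s x|)
      (integrable_const _)
      (L2_integrable_mul (f := fun x => |k 0| + M * |s x|) (g := fun x => |s x|)
        (MemLp.add (f := fun _ => |k 0|) (g := fun x => M * |s x|) (memLp_const _)
          (MemLp.const_mul (f := fun x => |s x|) hs.norm M)) hs.norm)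
  refine hb.mono' ?_ (Filter.Eventually.of_forall fun x =>
    abs_le_of_hasDerivAt_lipschitz hd hL _)
  have : Continuous d := continuous_iff_continuousAt.mpr fun x => (hd x).continuousAt
  exact this.comp_aestronglyMeasurable hs.1

/-- The dominating function comes from the quadratic expansion of the primitive around `0`, where it
vanishes. -/
theorem integrable_diffQuotPrimitive (hd : ∀ x, HasDerivAt d (k x) x)
    (hL : ∀ x y, |k x - k y| ≤ M * |x - y|) (hs₀ : MemLp s₀ 2 μ) (hs : MemLp s 2 μ) :
    Integrable (fun x => diffQuotPrimitive d (s x) (s₀ x)) μ := by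
  have hb : Integrable (fun x => |diffQuot d 0 (s₀ x) * s x| + M * (s x * s x)) μ :=
    (L2_integrable_mul (memLp_diffQuot hd hL hs₀ MemLp.zero') hs).abs.add
      ((L2_integrable_mul hs hs).const_mul M)
  refine hb.mono' ?_ (Filter.Eventually.of_forall fun x => ?_)
  · exact (continuous_diffQuotPrimitive hd
      (continuous_of_abs_sub_le hL)).comp_aestronglyMeasurable (hs.1.prodMk hs₀.1)
  · have h := abs_diffQuotPrimitive_sub_le hd hL 0 (s x) (s₀ x)
    have h0 : diffQuotPrimitive d 0 (s₀ x) = 0 := by simp [diffQuotPrimitive]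
    rw [zero_add, h0, sub_zero] at h
    have := abs_sub_abs_le_abs_sub (diffQuotPrimitive d (s x) (s₀ x)) (diffQuot d 0 (s₀ x) * s x)
    rw [Real.norm_eq_abs]
    linarith

theorem integrable_reactionEnergy (hw : AEStronglyMeasurable w μ) (hwUp : ∀ x, |w x| ≤ wUp)
    (hd : ∀ x, HasDerivAt d (k x) x)
    (hL : ∀ x y, |k x - k y| ≤ M * |x - y|) (hs₀ : MemLp s₀ 2 μ) (hs : MemLp s 2 μ) :
    Integrable (reactionEnergy w β d s₀ s) μ := by
  refine Integrable.add ?_ ((integrable_diffQuotPrimitive hd hL hs₀ hs).const_mul β)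
  have := (L2_integrable_mul (memLp_weight_mul hw hwUp (hs.sub hs₀)) (hs.sub hs₀)).div_const 2
  refine this.congr (Filter.Eventually.of_forall fun x => ?_)
  simp only [Pi.sub_apply]
  ring

/-- The operator on `L²` given by `reaction`. -/
theorem exists_reaction_operator (hw : AEStronglyMeasurable w μ) (hwUp : ∀ x, |w x| ≤ wUp)
    (hd : ∀ x, HasDerivAt d (k x) x)
    (hL : ∀ x y, |k x - k y| ≤ M * |x - y|) (s₀ : Lp ℝ 2 μ) :
    ∃ T : Lp ℝ 2 μ → Lp ℝ 2 μ, ∀ s h,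
      inner ℝ (T s) h = ∫ x, reaction w β d s₀ s x * h x ∂μ :=
  ⟨fun s => (memLp_reaction hw hwUp hd hL (Lp.memLp s₀) (Lp.memLp s)).toLp,
    fun _ h => L2_inner_toLp _ h⟩

theorem reactionEnergy_expansion (hw : AEStronglyMeasurable w μ) (hwUp : ∀ x, |w x| ≤ wUp)
    (hβ : 0 ≤ β) (hd : ∀ x, HasDerivAt d (k x) x)
    (hL : ∀ x y, |k x - k y| ≤ M * |x - y|) (s₀ s h : Lp ℝ 2 μ) :
    |∫ x, reactionEnergy w β d s₀ (s + h : Lp ℝ 2 μ) x ∂μ - ∫ x, reactionEnergy w β d s₀ s x ∂μ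
      - ∫ x, reaction w β d s₀ s x * h x ∂μ| ≤ (wUp / 2 + β * M) * ‖h‖ ^ 2 := by
  have i1 := integrable_reactionEnergy (β := β) hw hwUp hd hL (Lp.memLp s₀) (Lp.memLp (s + h))
  have i2 := integrable_reactionEnergy (β := β) hw hwUp hd hL (Lp.memLp s₀) (Lp.memLp s)
  have i3 := L2_integrable_mul (memLp_reaction (β := β) hw hwUp hd hL (Lp.memLp s₀) (Lp.memLp s))
    (Lp.memLp h)
  have i12 : Integrable (fun x => reactionEnergy w β d s₀ (s + h : Lp ℝ 2 μ) x
    - reactionEnergy w β d s₀ s x) μ := i1.sub i2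
  rw [← integral_sub i1 i2, ← integral_sub i12 i3, L2_norm_sq_eq_integral,
    ← integral_const_mul]
  refine (abs_integral_le_integral_abs).trans (integral_mono_ae (i12.sub i3).abs ?_ ?_)
  · exact ((Lp.memLp h).integrable_sq).const_mul _
  · filter_upwards [Lp.coeFn_add s h] with x hx
    simp only [reactionEnergy, reaction, hx, Pi.add_apply]
    have e : w x / 2 * (s x + h x - s₀ x) ^ 2 + β * diffQuotPrimitive d (s x + h x) (s₀ x)
        - (w x / 2 * (s x - s₀ x) ^ 2 + β * diffQuotPrimitive d (s x) (s₀ x))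
        - (w x * (s x - s₀ x) + β * diffQuot d (s x) (s₀ x)) * h x
        = w x / 2 * h x ^ 2 + β * (diffQuotPrimitive d (s x + h x) (s₀ x)
          - diffQuotPrimitive d (s x) (s₀ x) - diffQuot d (s x) (s₀ x) * h x) := by ring
    rw [e]
    refine (abs_add_le _ _).trans ?_
    have b1 : |w x / 2 * h x ^ 2| ≤ wUp / 2 * h x ^ 2 := by
      rw [abs_mul, abs_div, abs_sq, abs_two]
      gcongr
      exact hwUp x
    have b2 := mul_le_mul_of_nonneg_left
      (abs_diffQuotPrimitive_sub_le hd hL (s x) (h x) (s₀ x)) hβ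
    rw [abs_mul β, abs_of_nonneg hβ]
    linarith

/-- Multiplied by the increment, the quotient becomes `d(s₀ + h) - d(s₀)`, whose first term is
dropped by nonnegativity. No relation between `wLow` and `M` is needed, which is why existence holds
for every step size. -/
theorem reaction_coercive (hw : AEStronglyMeasurable w μ) (hwUp : ∀ x, |w x| ≤ wUp)
    (hwLow : ∀ x, wLow ≤ w x)
    (hβ : 0 ≤ β) (hd : ∀ x, HasDerivAt d (k x) x)
    (hL : ∀ x y, |k x - k y| ≤ M * |x - y|) (hd0 : ∀ x, 0 ≤ d x) (s₀ h : Lp ℝ 2 μ) :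
    wLow * ‖h‖ ^ 2 - β * ∫ x, d (s₀ x) ∂μ
      ≤ ∫ x, reaction w β d s₀ (s₀ + h : Lp ℝ 2 μ) x * h x ∂μ := by
  have i3 := L2_integrable_mul (memLp_reaction (β := β) hw hwUp hd hL (Lp.memLp s₀)
    (Lp.memLp (s₀ + h))) (Lp.memLp h)
  have i1 := ((Lp.memLp h).integrable_sq).const_mul wLow
  have i2 := (integrable_comp_of_hasDerivAt_lipschitz hd hL (Lp.memLp s₀)).const_mul β
  rw [L2_norm_sq_eq_integral, ← integral_const_mul, ← integral_const_mul, ← integral_sub i1 i2]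
  refine integral_mono_ae (i1.sub i2) i3 ?_
  filter_upwards [Lp.coeFn_add s₀ h] with x hx
  simp only [reaction, hx, Pi.add_apply]
  have e := diffQuot_mul_sub d (s₀ x + h x) (s₀ x)
  rw [add_sub_cancel_left] at e ⊢
  have h1 := mul_le_mul_of_nonneg_right (hwLow x) (sq_nonneg (h x))
  have h2 := mul_nonneg hβ (hd0 (s₀ x + h x))
  have e2 : (w x * h x + β * diffQuot d (s₀ x + h x) (s₀ x)) * h x
      = w x * h x ^ 2 + β * d (s₀ x + h x) - β * d (s₀ x) := by
    rw [add_mul, mul_assoc β, e]; ring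
  rw [e2]
  linarith

/-- The weight contributes `wLow`; the quotient, being `M`-Lipschitz in its first argument, costs at
most `β * M`. -/
theorem reaction_strongly_monotone (hw : AEStronglyMeasurable w μ) (hwUp : ∀ x, |w x| ≤ wUp)
    (hwLow : ∀ x, wLow ≤ w x)
    (hβ : 0 ≤ β) (hd : ∀ x, HasDerivAt d (k x) x)
    (hL : ∀ x y, |k x - k y| ≤ M * |x - y|) (s₀ s s' : Lp ℝ 2 μ) :
    (wLow - β * M) * ‖s - s'‖ ^ 2
      ≤ ∫ x, reaction w β d s₀ s x * (s - s' : Lp ℝ 2 μ) x ∂μ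
        - ∫ x, reaction w β d s₀ s' x * (s - s' : Lp ℝ 2 μ) x ∂μ := by
  have i1 := L2_integrable_mul (memLp_reaction (β := β) hw hwUp hd hL (Lp.memLp s₀)
    (Lp.memLp s)) (Lp.memLp (s - s'))
  have i2 := L2_integrable_mul (memLp_reaction (β := β) hw hwUp hd hL (Lp.memLp s₀)
    (Lp.memLp s')) (Lp.memLp (s - s'))
  rw [← integral_sub i1 i2, L2_norm_sq_eq_integral, ← integral_const_mul]
  refine integral_mono_ae (((Lp.memLp (s - s')).integrable_sq).const_mul _) (i1.sub i2) ?_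
  filter_upwards [Lp.coeFn_sub s s'] with x hx
  simp only [reaction, hx, Pi.sub_apply]
  have hg := abs_diffQuot_sub_le hd hL (s x) (s' x) (s₀ x) (s₀ x)
  rw [sub_self, abs_zero, add_zero] at hg
  set δ := s x - s' x with hδ
  have h1 := mul_le_mul_of_nonneg_right (hwLow x) (sq_nonneg δ)
  have h2 : -(M * δ ^ 2) ≤ (diffQuot d (s x) (s₀ x) - diffQuot d (s' x) (s₀ x)) * δ := by
    have := neg_abs_le ((diffQuot d (s x) (s₀ x) - diffQuot d (s' x) (s₀ x)) * δ)
    rw [abs_mul] at this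
    have h3 := mul_le_mul_of_nonneg_right hg (abs_nonneg δ)
    rw [mul_assoc, ← sq, sq_abs] at h3
    linarith
  have h3 := mul_le_mul_of_nonneg_left h2 hβ
  have e : (w x * (s x - s₀ x) + β * diffQuot d (s x) (s₀ x)) * δ
      - (w x * (s' x - s₀ x) + β * diffQuot d (s' x) (s₀ x)) * δ
      = w x * δ ^ 2 + β * ((diffQuot d (s x) (s₀ x) - diffQuot d (s' x) (s₀ x)) * δ) := by
    rw [hδ]; ring
  rw [e]
  linarith

end Reaction

/-! ### The abstract Galerkin system. -/

section GalerkinSystem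

variable {E H₁ H₂ : Type*} [NormedAddCommGroup E] [NormedSpace ℝ E]
  [NormedAddCommGroup H₁] [InnerProductSpace ℝ H₁] [NormedAddCommGroup H₂] [InnerProductSpace ℝ H₂]

/-- Existence for the finite-dimensional system `⟪T (ι S), ι v⟫ + α ⟪γ S, γ v⟫ = 0` when `T` is
the gradient of `N` and is coercive around `ι S₀`. -/
theorem exists_galerkin_solution [FiniteDimensional ℝ E] {ι : E →ₗ[ℝ] H₁} {γ : E →ₗ[ℝ] H₂}
    (hι : ∀ v, ‖ι v‖ ≤ ‖v‖) (hγ : ∀ v, ‖γ v‖ ≤ ‖v‖)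
    (hιγ : ∀ v, ‖v‖ ^ 2 ≤ ‖ι v‖ ^ 2 + ‖γ v‖ ^ 2)
    {T : H₁ → H₁} {N : H₁ → ℝ} {C a B α : ℝ} (hα : 0 < α) (ha : 0 < a) (S₀ : E)
    (hN : ∀ s h, |N (s + h) - N s - inner ℝ (T s) h| ≤ C * ‖h‖ ^ 2)
    (hT : ∀ h, a * ‖h‖ ^ 2 - B ≤ inner ℝ (T (ι S₀ + h)) h) :
    ∃ S, ∀ v, inner ℝ (T (ι S)) (ι v) + α * inner ℝ (γ S) (γ v) = 0 := by
  -- The unknown is the increment `w` from `S₀`, since the coercivity is centred there.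
  let F : E → E →ₗ[ℝ] ℝ := fun w =>
    (innerₛₗ ℝ (T (ι (S₀ + w)))).comp ι + α • (innerₛₗ ℝ (γ (S₀ + w))).comp γ
  have hF : ∀ w v, F w v
      = inner ℝ (T (ι (S₀ + w))) (ι v) + α * inner ℝ (γ (S₀ + w)) (γ v) := fun w v => rfl
  let J : E → ℝ := fun w => N (ι (S₀ + w)) + α / 2 * ‖γ (S₀ + w)‖ ^ 2
  set D := |B| + α / 2 * ‖γ S₀‖ ^ 2 with hD
  have hD0 : 0 ≤ D := by positivity
  set m := min a (α / 2) with hm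
  have hm0 : 0 < m := lt_min ha (by positivity)
  have hJ : ∀ w v, |J (w + v) - J w - F w v| ≤ (|C| + α / 2) * ‖v‖ ^ 2 := by
    intro w v
    have h1 := hN (ι (S₀ + w)) (ι v)
    have e : J (w + v) - J w - F w v
        = (N (ι (S₀ + w) + ι v) - N (ι (S₀ + w)) - inner ℝ (T (ι (S₀ + w))) (ι v))
          + α / 2 * ‖γ v‖ ^ 2 := by
      simp only [J, hF, ← add_assoc, map_add ι (S₀ + w) v, map_add γ (S₀ + w) v]
      rw [norm_add_sq_real (γ (S₀ + w)) (γ v)]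
      ring
    rw [e]
    refine (abs_add_le _ _).trans ?_
    rw [abs_of_nonneg (by positivity : 0 ≤ α / 2 * ‖γ v‖ ^ 2), add_mul]
    have h2 : C * ‖ι v‖ ^ 2 ≤ |C| * ‖v‖ ^ 2 :=
      mul_le_mul (le_abs_self C) (pow_le_pow_left₀ (norm_nonneg _) (hι v) 2) (by positivity)
        (abs_nonneg C)
    have h3 : ‖γ v‖ ^ 2 ≤ ‖v‖ ^ 2 := pow_le_pow_left₀ (norm_nonneg _) (hγ v) 2
    have h4 := mul_le_mul_of_nonneg_left h3 (by positivity : 0 ≤ α / 2)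
    linarith
  -- `F w w ≥ m * ‖w‖ ^ 2 - D`, and the radius exceeds `1`, so its square times `m` is still larger
  -- than `D`.
  have hpos : ∀ w, ‖w‖ = D / m + 1 → 0 < F w w := by
    intro w hw
    have h1 := hT (ι w)
    -- Young's inequality spends half of the diffusion term on the cross term; hence `α / 2` in `m`
    -- and in `D`.
    have h2 : -(1 / 2 * (‖γ S₀‖ ^ 2 + ‖γ w‖ ^ 2)) ≤ inner ℝ (γ S₀) (γ w) := by
      have := norm_add_sq_real (γ S₀) (γ w)
      have := sq_nonneg ‖γ S₀ + γ w‖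
      linarith
    have h3 := mul_le_mul_of_nonneg_left h2 hα.le
    rw [hF, map_add, map_add, inner_add_left, real_inner_self_eq_norm_sq]
    have h4 := mul_le_mul_of_nonneg_left (hιγ w) hm0.le
    have h5 := mul_le_mul_of_nonneg_right (min_le_left a (α / 2)) (sq_nonneg ‖ι w‖)
    have h6 := mul_le_mul_of_nonneg_right (min_le_right a (α / 2)) (sq_nonneg ‖γ w‖)
    have h7 : D < m * ‖w‖ ^ 2 := by
      rw [hw]
      have hq : 0 ≤ D / m := by positivity
      calc D < m * (D / m + 1) := by rw [mul_add, mul_div_cancel₀ _ hm0.ne']; linarith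
        _ ≤ m * (D / m + 1) ^ 2 := by
          apply mul_le_mul_of_nonneg_left _ hm0.le
          nlinarith
    have h8 := le_abs_self B
    rw [← hm] at h5 h6
    nlinarith
  obtain ⟨w, hw⟩ := exists_forall_eq_zero_of_expansion (by positivity) hJ hpos
  exact ⟨S₀ + w, fun v => by rw [← hF, hw]⟩

/-- Both equations are tested with `S - S'` and subtracted; the diffusion part is nonnegative, so
strong monotonicity leaves no room for `ι S ≠ ι S'`. -/
theorem galerkin_solution_unique {ι : E →ₗ[ℝ] H₁} {γ : E →ₗ[ℝ] H₂} {T : H₁ → H₁} {α a : ℝ}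
    (hα : 0 ≤ α) (ha : 0 < a)
    (hT : ∀ s s', a * ‖s - s'‖ ^ 2 ≤ inner ℝ (T s) (s - s') - inner ℝ (T s') (s - s')) {S S' : E}
    (hS : ∀ v, inner ℝ (T (ι S)) (ι v) + α * inner ℝ (γ S) (γ v) = 0)
    (hS' : ∀ v, inner ℝ (T (ι S')) (ι v) + α * inner ℝ (γ S') (γ v) = 0) : ι S = ι S' := by
  have h1 := hS (S - S')
  have h2 := hS' (S - S')
  have h3 := hT (ι S) (ι S')
  rw [map_sub, map_sub] at h1 h2
  have h4 : inner ℝ (γ S) (γ S - γ S') - inner ℝ (γ S') (γ S - γ S') = ‖γ S - γ S'‖ ^ 2 := by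
    rw [← inner_sub_left, real_inner_self_eq_norm_sq]
  have h5 : 0 ≤ α * ‖γ S - γ S'‖ ^ 2 := by positivity
  rw [← h4] at h5
  have h6 : a * ‖ι S - ι S'‖ ^ 2 ≤ 0 := by linarith
  have h7 : ‖ι S - ι S'‖ ^ 2 ≤ 0 := nonpos_of_mul_nonpos_right h6 ha
  have h8 : ‖ι S - ι S'‖ = 0 := pow_eq_zero_iff (two_ne_zero) |>.mp (le_antisymm h7 (sq_nonneg _))
  exact sub_eq_zero.mp (norm_eq_zero.mp h8)

variable {G : Submodule ℝ (H₁ × H₂)}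

/-- The product carries the maximum norm, which dominates each component and whose square is at most
the sum of their squares; that is all the abstract system asks of the norm. -/
theorem exists_galerkin_solution_submodule (W : Submodule ℝ G) [FiniteDimensional ℝ W]
    {T : H₁ → H₁} {N : H₁ → ℝ} {C a B α : ℝ} (hα : 0 < α) (ha : 0 < a) (S₀ : W)
    (hN : ∀ s h, |N (s + h) - N s - inner ℝ (T s) h| ≤ C * ‖h‖ ^ 2)
    (hT : ∀ h, a * ‖h‖ ^ 2 - B ≤ inner ℝ (T (S₀.1.1.1 + h)) h) :
    ∃ S : W, ∀ v : W, inner ℝ (T S.1.1.1) v.1.1.1 + α * inner ℝ S.1.1.2 v.1.1.2 = 0 := by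
  refine exists_galerkin_solution
    (ι := (LinearMap.fst ℝ H₁ H₂).comp (G.subtype.comp W.subtype))
    (γ := (LinearMap.snd ℝ H₁ H₂).comp (G.subtype.comp W.subtype))
    (fun v => norm_fst_le v.1.1) (fun v => norm_snd_le v.1.1) (fun v => ?_) hα ha S₀ hN hT
  show ‖v.1.1‖ ^ 2 ≤ ‖v.1.1.1‖ ^ 2 + ‖v.1.1.2‖ ^ 2
  rw [Prod.norm_def]
  rcases max_cases ‖v.1.1.1‖ ‖v.1.1.2‖ with h | h <;> rw [h.1] <;>
    nlinarith [sq_nonneg ‖v.1.1.1‖, sq_nonneg ‖v.1.1.2‖]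

theorem galerkin_solution_submodule_unique {W : Submodule ℝ G} {T : H₁ → H₁} {α a : ℝ}
    (hα : 0 ≤ α) (ha : 0 < a)
    (hT : ∀ s s', a * ‖s - s'‖ ^ 2 ≤ inner ℝ (T s) (s - s') - inner ℝ (T s') (s - s')) {S S' : W}
    (hS : ∀ v : W, inner ℝ (T S.1.1.1) v.1.1.1 + α * inner ℝ S.1.1.2 v.1.1.2 = 0)
    (hS' : ∀ v : W, inner ℝ (T S'.1.1.1) v.1.1.1 + α * inner ℝ S'.1.1.2 v.1.1.2 = 0) :
    S.1.1.1 = S'.1.1.1 := by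
  let ι : W →ₗ[ℝ] H₁ := (LinearMap.fst ℝ H₁ H₂).comp (G.subtype.comp W.subtype)
  let γ : W →ₗ[ℝ] H₂ := (LinearMap.snd ℝ H₁ H₂).comp (G.subtype.comp W.subtype)
  exact galerkin_solution_unique (E := W) (S := S) (S' := S') (ι := ι) (γ := γ) hα ha hT hS hS'

end GalerkinSystem

/-! ### One step of the scheme as a Galerkin system. -/

section Step

variable {m : ℕ} {Ω : Set (EuclideanSpace ℝ (Fin m))}

/-- The weight of the discrete time derivative in one step of the scheme. -/
noncomputable def stepWeight (c : ℝ → ℝ) (τ : ℝ) (S₀ : H1 Ω) (x : EuclideanSpace ℝ (Fin m)) : ℝ :=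
  c ‖H1.grad S₀ x‖ / τ

theorem aestronglyMeasurable_stepWeight {c : ℝ → ℝ} (hc : Continuous c) (τ : ℝ) (S₀ : H1 Ω) :
    AEStronglyMeasurable (stepWeight c τ S₀) (volume.restrict Ω) :=
  AEStronglyMeasurable.congr
    ((hc.div_const τ).comp_aestronglyMeasurable (Lp.aestronglyMeasurable S₀.1.2).norm)
    Filter.EventuallyEq.rfl

theorem H1.memLp_fn (u : H1 Ω) : MemLp (H1.fn u) 2 (volume.restrict Ω) := Lp.memLp u.1.1

theorem H1.integral_inner_grad (u v : H1 Ω) :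
    ∫ x in Ω, inner ℝ (H1.grad u x) (H1.grad v x) = inner ℝ u.1.2 v.1.2 :=
  (L2.inner_def _ _).symm

theorem integral_reaction_mul [IsFiniteMeasure (volume.restrict Ω)] {β : ℝ} {c d k : ℝ → ℝ}
    {M cUp τ : ℝ} (hc : Continuous c) {S₀ : H1 Ω} (hw : ∀ x, |stepWeight c τ S₀ x| ≤ cUp)
    (hd : ∀ x, HasDerivAt d (k x) x) (hL : ∀ x y, |k x - k y| ≤ M * |x - y|) (S v : H1 Ω) :
    ∫ x in Ω, reaction (stepWeight c τ S₀) β d (H1.fn S₀) (H1.fn S) x * H1.fn v x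
      = (∫ x in Ω, c ‖H1.grad S₀ x‖ * ((1 / τ) * (H1.fn S x - H1.fn S₀ x)) * H1.fn v x)
        + ∫ x in Ω, β * diffQuot d (H1.fn S x) (H1.fn S₀ x) * H1.fn v x := by
  have i1 : Integrable (fun x => stepWeight c τ S₀ x * (H1.fn S x - H1.fn S₀ x)
      * H1.fn v x) (volume.restrict Ω) :=
    L2_integrable_mul (memLp_weight_mul (aestronglyMeasurable_stepWeight hc τ S₀) hw
      ((H1.memLp_fn S).sub (H1.memLp_fn S₀))) (H1.memLp_fn v)
  have i2 : Integrable (fun x => β * diffQuot d (H1.fn S x) (H1.fn S₀ x) * H1.fn v x)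
      (volume.restrict Ω) :=
    L2_integrable_mul ((memLp_diffQuot hd hL (H1.memLp_fn S₀)
      (H1.memLp_fn S)).const_mul β) (H1.memLp_fn v)
  have e : ∀ x, c ‖H1.grad S₀ x‖ * ((1 / τ) * (H1.fn S x - H1.fn S₀ x)) * H1.fn v x
      = stepWeight c τ S₀ x * (H1.fn S x - H1.fn S₀ x) * H1.fn v x := fun x => by
    unfold stepWeight; ring
  simp only [e]
  rw [← integral_add i1 i2]
  simp only [reaction, add_mul]

theorem integral_inner_smul_grad (α : ℝ) (u v : H1 Ω) :
    ∫ x in Ω, inner ℝ (α • H1.grad u x) (H1.grad v x) = α * inner ℝ u.1.2 v.1.2 := by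
  simp only [real_inner_smul_left]
  rw [integral_const_mul, H1.integral_inner_grad]

theorem isStepSolution_iff [IsFiniteMeasure (volume.restrict Ω)] {α β : ℝ} {c d k : ℝ → ℝ}
    {M cUp τ : ℝ} (hc : Continuous c) {Vh : Submodule ℝ (H1 Ω)} {S₀ : Vh}
    (hw : ∀ x, |stepWeight c τ S₀.1 x| ≤ cUp)
    (hd : ∀ x, HasDerivAt d (k x) x) (hL : ∀ x y, |k x - k y| ≤ M * |x - y|) (S : Vh) :
    IsStepSolution α β c d Vh τ S₀ S ↔ ∀ v : Vh,
      (∫ x in Ω, reaction (stepWeight c τ S₀.1) β d (H1.fn S₀.1) (H1.fn S.1) x * H1.fn v.1 x)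
        + α * (inner ℝ S.1.1.2 v.1.1.2 : ℝ) = 0 := by
  have aux : ∀ {A B C D I : ℝ}, D = A + C → B = I → (A + B + C = 0 ↔ D + I = 0) := by
    rintro A B C D I rfl rfl
    rw [add_right_comm]
  exact forall_congr' fun v => aux (integral_reaction_mul hc hw hd hL S.1 v.1)
    (integral_inner_smul_grad α S.1 v.1)

theorem le_stepWeight {c : ℝ → ℝ} {cLow τ : ℝ} (hτ : 0 < τ) (hlow : ∀ x, cLow ≤ c x) (S₀ : H1 Ω)
    (x : EuclideanSpace ℝ (Fin m)) : cLow / τ ≤ stepWeight c τ S₀ x :=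
  div_le_div_of_nonneg_right (hlow _) hτ.le

theorem abs_stepWeight_le {c : ℝ → ℝ} {cLow cUp τ : ℝ} (hτ : 0 < τ) (hcLow : 0 < cLow)
    (hlow : ∀ x, cLow ≤ c x) (hup : ∀ x, c x ≤ cUp) (S₀ : H1 Ω)
    (x : EuclideanSpace ℝ (Fin m)) : |stepWeight c τ S₀ x| ≤ cUp / τ := by
  rw [abs_of_nonneg ((div_pos hcLow hτ).le.trans (le_stepWeight hτ hlow S₀ x))]
  exact div_le_div_of_nonneg_right (hup _) hτ.le

theorem isStepSolution_iff_inner [IsFiniteMeasure (volume.restrict Ω)] {α β : ℝ} {c d k : ℝ → ℝ}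
    {M cUp τ : ℝ} (hc : Continuous c) {Vh : Submodule ℝ (H1 Ω)} {S₀ : Vh}
    (hw : ∀ x, |stepWeight c τ S₀.1 x| ≤ cUp)
    (hd : ∀ x, HasDerivAt d (k x) x) (hL : ∀ x y, |k x - k y| ≤ M * |x - y|)
    {T : Lp ℝ 2 (volume.restrict Ω) → Lp ℝ 2 (volume.restrict Ω)}
    (hT : ∀ s h, inner ℝ (T s) h
      = ∫ x in Ω, reaction (stepWeight c τ S₀.1) β d S₀.1.1.1 s x * h x) (S : Vh) :
    IsStepSolution α β c d Vh τ S₀ S ↔ ∀ v : Vh,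
      inner ℝ (T S.1.1.1) v.1.1.1 + α * inner ℝ S.1.1.2 v.1.1.2 = 0 :=
  (isStepSolution_iff hc hw hd hL S).trans (forall_congr' fun v =>
    Eq.congr_left (congrArg (· + α * inner ℝ S.1.1.2 v.1.1.2) (hT S.1.1.1 v.1.1.1).symm))

theorem exists_isStepSolution [IsFiniteMeasure (volume.restrict Ω)] {α β : ℝ} {c d k : ℝ → ℝ}
    {M cLow cUp τ : ℝ} (hα : 0 < α) (hβ : 0 < β) (hτ : 0 < τ) (hcc : Continuous c)
    (hcLow : 0 < cLow) (hlow : ∀ x, cLow ≤ c x) (hup : ∀ x, c x ≤ cUp)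
    (hd : ∀ x, HasDerivAt d (k x) x) (hL : ∀ x y, |k x - k y| ≤ M * |x - y|)
    (hd0 : ∀ x, 0 ≤ d x) (Vh : Submodule ℝ (H1 Ω)) [FiniteDimensional ℝ Vh] (S₀ : Vh) :
    ∃ S : Vh, IsStepSolution α β c d Vh τ S₀ S := by
  have hwUp := abs_stepWeight_le hτ hcLow hlow hup S₀.1
  have hw := aestronglyMeasurable_stepWeight hcc τ S₀.1
  obtain ⟨T, hT⟩ := exists_reaction_operator (β := β) hw hwUp hd hL S₀.1.1.1
  have hco : ∀ h : Lp ℝ 2 (volume.restrict Ω),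
      cLow / τ * ‖h‖ ^ 2 - β * ∫ x in Ω, d (S₀.1.1.1 x) ≤ inner ℝ (T (S₀.1.1.1 + h)) h := fun h =>
    (reaction_coercive hw hwUp (le_stepWeight hτ hlow S₀.1) hβ.le hd hL hd0 S₀.1.1.1 h).trans_eq
      (hT _ h).symm
  obtain ⟨S, hS⟩ := exists_galerkin_solution_submodule Vh (T := T)
    (N := fun s => ∫ x in Ω, reactionEnergy (stepWeight c τ S₀.1) β d S₀.1.1.1 s x)
    (C := cUp / τ / 2 + β * M) hα (div_pos hcLow hτ) S₀
    (fun s h => by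
      rw [hT s h]
      exact reactionEnergy_expansion hw hwUp hβ.le hd hL S₀.1.1.1 s h) hco
  exact ⟨S, (isStepSolution_iff_inner hcc hwUp hd hL hT S).2 hS⟩

theorem isStepSolution_unique [IsFiniteMeasure (volume.restrict Ω)] {α β : ℝ} {c d k : ℝ → ℝ}
    {M cLow cUp τ : ℝ} (hα : 0 < α) (hβ : 0 < β) (hτ : 0 < τ) (hcc : Continuous c)
    (hcLow : 0 < cLow) (hlow : ∀ x, cLow ≤ c x) (hup : ∀ x, c x ≤ cUp)
    (hd : ∀ x, HasDerivAt d (k x) x) (hL : ∀ x y, |k x - k y| ≤ M * |x - y|)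
    (hsmall : β * M < cLow / τ) (hΩ : IsOpen Ω) (Vh : Submodule ℝ (H1 Ω)) {S₀ S S' : Vh}
    (hS : IsStepSolution α β c d Vh τ S₀ S) (hS' : IsStepSolution α β c d Vh τ S₀ S') :
    S = S' := by
  have hwUp := abs_stepWeight_le hτ hcLow hlow hup S₀.1
  have hw := aestronglyMeasurable_stepWeight hcc τ S₀.1
  obtain ⟨T, hT⟩ := exists_reaction_operator (β := β) hw hwUp hd hL S₀.1.1.1
  rw [isStepSolution_iff_inner hcc hwUp hd hL hT] at hS hS'
  -- Monotonicity identifies only the L² components; openness of `Ω` then fixes the weak gradients.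
  refine Subtype.ext (H1.ext hΩ (galerkin_solution_submodule_unique hα.le (sub_pos.mpr hsmall)
    (fun s s' => ?_) hS hS'))
  rw [hT, hT]
  exact reaction_strongly_monotone hw hwUp (le_stepWeight hτ hlow S₀.1) hβ.le hd hL S₀.1.1.1 s s'

end Step

/-! ### The step-size threshold and the conclusion. -/

theorem mainTheorem2 {m : ℕ} (Ω : Set (EuclideanSpace ℝ (Fin m)))
    (hΩ_open : IsOpen Ω) (hΩ_bdd : Bornology.IsBounded Ω)
    (α β : ℝ) (hα : 0 < α) (hβ : 0 < β)
    (c d : ℝ → ℝ) (cLow cUp dLow d₁ dUp : ℝ)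
    (hc : AssumptionA1 c cLow cUp) (hd : AssumptionA2 d dLow d₁ dUp) :
    ∃ τ₀ : ℝ, 0 < τ₀ ∧
      ∀ (Vh : Submodule ℝ (H1 Ω)), FiniteDimensional ℝ Vh → ∀ S₀ : Vh,
        (∀ τ : ℝ, 0 < τ → ∃ S : Vh, IsStepSolution α β c d Vh τ S₀ S) ∧
        (∀ τ : ℝ, 0 < τ → τ ≤ τ₀ → ∃! S : Vh, IsStepSolution α β c d Vh τ S₀ S) := by
  obtain ⟨k, hk, hL⟩ := hd.sobolev.exists_hasDerivAt
  have hM : 0 ≤ dUp := by simpa using (abs_nonneg _).trans (hL 1 0)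
  have hcLow := hc.pos
  have hcc : Continuous c := hc.sobolev.1
  have : IsFiniteMeasure (volume.restrict Ω) := ⟨by simpa using hΩ_bdd.measure_lt_top⟩
  -- The `+ 1` allows `dUp = 0` and makes `β * dUp < cLow / τ` strict even at `τ = τ₀`.
  refine ⟨cLow / (β * dUp + 1), by positivity, fun Vh hVh S₀ => ?_⟩
  have hex : ∀ τ : ℝ, 0 < τ → ∃ S : Vh, IsStepSolution α β c d Vh τ S₀ S := fun τ hτ =>
    exists_isStepSolution hα hβ hτ hcc hcLow hc.lower hc.upper hk hL hd.nonneg Vh S₀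
  refine ⟨hex, fun τ hτ hτ₀ => existsUnique_of_exists_of_unique (hex τ hτ) fun S S' hS hS' =>
    isStepSolution_unique hα hβ hτ hcc hcLow hc.lower hc.upper hk hL ?_ hΩ_open Vh hS hS'⟩
  rw [le_div_iff₀ (by positivity)] at hτ₀
  rw [lt_div_iff₀ hτ]
  linarith
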